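/- Let $F$ be a field of characteristic zero and $L$ a Lie algebra over $F$. An $L$-algebra is an associative (not necessarily unital) $F$-algebra on which $L$ acts by derivations; the action extends to the universal enveloping algebra $U(L)$. Fix any basis $(h_i)_{i\in I}$ of $U(L)$ and let $F\langle X|L\rangle$ be the free associative algebra (without constant terms) on the symbols $x_j^{h_i}$ ($j\in\mathbb{N}$, $i\in I$), where $x_j^{h_i}$ is evaluated at $x_j=a$ as $h_i(a)$. The set of those $f\in F\langle X|L\rangle$ that vanish under all substitutions from an $L$-algebra $A$ is denoted $\mathrm{Id}^L(A)$ (the differential identities of $A$). An $L$-variety $\mathcal V$ is the class of all $L$-algebras satisfying a given set of differential identities; $\mathrm{Id}^L(\mathcal V)$ is the set of differential identities that hold in all its members, and $\mathrm{var}^L(A)$ is the class of all $L$-algebras satisfying every identity in $\mathrm{Id}^L(A)$. Let $P_n^L$ be the span of the monomials $x_{\sigma(1)}^{h_{i_1}}\cdots x_{\sigma(n)}^{h_{i_n}}$ with $\sigma\in S_n$ and $i_1,\dots,i_n\in I$, and let $c_n^L(\mathcal V)=\dim P_n^L/(P_n^L\cap \mathrm{Id}^L(\mathcal V))$, $n\ge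 1$. We say that $\mathcal V$ has polynomial growth if the $c_n^L(\mathcal V)$ are finite and bounded by a polynomial in $n$; that it has exponential growth if they are finite and there are real numbers $r>1$ and $s$ with $r^n\le c_n^L(\mathcal V)\le s^n$ for all large $n$; and that it has almost polynomial growth if $\mathcal V$ does not have polynomial growth but every $L$-variety properly contained in $\mathcal V$ does. Let $UT_2$ be the algebra of upper triangular $2\times 2$ matrices over $F$, and let $\delta$ be its inner derivation $\delta(a)=2^{-1}(e_{12}a-ae_{12})$. Let $UT_2^\delta$ be the algebra $UT_2$ on which $L$ acts as the one-dimensional Lie algebra $F\delta$, that is, through a Lie algebra homomorphism $L\to\mathrm{Der}(UT_2)$ with image $F\delta$, and let $UT_2$ also denote the same algebra with the trivial $L$-action. Then: 1. $\mathrm{var}^L(UT_2^\delta)$ has exponential growth; 2. $\mathrm{var}^L(UT_2^\delta)$ does not have almost polynomial growth; 3. $UT_2\in \mathrm{var}^L(UT_2^\delta)$, the variety $\mathrm{var}^L(UT_2)$ is a proper subvariety of $\mathrm{var}^L(UT_2^\delta)$, and $\mathrm{var}^L(UT_2)$ has exponential growth. -/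

import Mathlib

universe u v

/- Associative algebras, such as `Module.End F A`, are Lie algebras under the commutator. -/
attribute [local instance] LieRing.ofAssociativeRing

/-- An `L`-algebra over `F`: an associative (not necessarily unital) `F`-algebra on which the Lie
algebra `L` acts by derivations. -/
structure LAlg (F L : Type u) [Field F] [LieRing L] [LieAlgebra F L] where
  carrier : Type u
  [ring : NonUnitalRing carrier]
  [module : Module F carrier]
  [isScalarTower : IsScalarTower F carrier carrier]
  [smulCommClass : SMulCommClass F carrier carrier]
  action : L →ₗ⁅F⁆ Module.End F carrier
  leibniz : ∀ (γ : L) (x y : carrier), action γ (x * y) = action γ x * y + x * action γ y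

attribute [instance] LAlg.ring LAlg.module LAlg.isScalarTower LAlg.smulCommClass

/-- The extension of the `L`-action on `A` to the universal enveloping algebra `U(L)`. -/
noncomputable def LAlg.uAction {F L : Type u} [Field F] [LieRing L] [LieAlgebra F L]
    (A : LAlg F L) : UniversalEnvelopingAlgebra F L →ₐ[F] Module.End F A.carrier :=
  UniversalEnvelopingAlgebra.lift F A.action

/-- The free associative algebra `F⟨X|L⟩` on the generators `x_j^{h_i}` (the pairs `(j, i)`), where
`(h_i)_{i ∈ I}` is a basis of `U(L)`. As the algebras that we consider need not have a unit, its
elements are the differential polynomials without constant term. -/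
abbrev DiffPoly (F : Type u) (I : Type v) [Field F] : Type (max u v) :=
  MonoidAlgebra F (FreeSemigroup (ℕ × I))

/-- Evaluation `f ↦ f(a_0, a_1, …)` of differential polynomials in `A`: the algebra homomorphism
that sends `x_j^{h_i}` to `h_i(a_j)`. -/
noncomputable def LAlg.eval {F L : Type u} {I : Type v} [Field F] [LieRing L] [LieAlgebra F L]
    (b : Module.Basis I F (UniversalEnvelopingAlgebra F L)) (A : LAlg F L) (a : ℕ → A.carrier) :
    DiffPoly F I →ₙₐ[F] A.carrier :=
  MonoidAlgebra.liftMagma F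
    (FreeSemigroup.lift fun p : ℕ × I => A.uAction (b p.2) (a p.1))

/-- `Id^L(A)`: the differential identities of `A`. -/
noncomputable def LAlg.identities {F L : Type u} {I : Type v} [Field F] [LieRing L] [LieAlgebra F L]
    (b : Module.Basis I F (UniversalEnvelopingAlgebra F L)) (A : LAlg F L) :
    Submodule F (DiffPoly F I) where
  carrier := {f | ∀ a : ℕ → A.carrier, A.eval b a f = 0}
  add_mem' := by
    intro f g hf hg a
    rw [map_add, hf a, hg a, add_zero]
  zero_mem' := fun a => map_zero (A.eval b a)
  smul_mem' := by
    intro c f hf a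
    rw [map_smul, hf a, smul_zero]

/-- The differential identities that hold in all members of a class of `L`-algebras. -/
noncomputable def classIdentities {F L : Type u} {I : Type v} [Field F] [LieRing L] [LieAlgebra F L]
    (b : Module.Basis I F (UniversalEnvelopingAlgebra F L)) (V : Set (LAlg F L)) :
    Submodule F (DiffPoly F I) :=
  ⨅ A ∈ V, A.identities b

/-- An `L`-variety: the class of all `L`-algebras that satisfy a given set of differential
identities. -/
def IsLVariety {F L : Type u} {I : Type v} [Field F] [LieRing L] [LieAlgebra F L]
    (b : Module.Basis I F (UniversalEnvelopingAlgebra F L)) (V : Set (LAlg F L)) : Prop :=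
  ∃ S : Set (DiffPoly F I), V = {A | ∀ f ∈ S, f ∈ A.identities b}

/-- `var^L(A)`: the class of all `L`-algebras satisfying all differential identities of `A`. -/
def varL {F L : Type u} {I : Type v} [Field F] [LieRing L] [LieAlgebra F L]
    (b : Module.Basis I F (UniversalEnvelopingAlgebra F L)) (A : LAlg F L) : Set (LAlg F L) :=
  {B | ∀ f ∈ A.identities b, f ∈ B.identities b}

/-- `P_n^L` (for `n ≥ 1`): the span of the monomials
`x_{σ(0)}^{h_{i_0}} ⋯ x_{σ(n-1)}^{h_{i_{n-1}}}` with `σ` a permutation of `{0, …, n-1}`. -/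
noncomputable def multilinearPoly (F : Type u) (I : Type v) [Field F] (n : ℕ) : Submodule F (DiffPoly F I) :=
  Submodule.span F {f | ∃ (w : FreeSemigroup (ℕ × I)) (σ : Equiv.Perm (Fin n)) (i : Fin n → I),
    w.head :: w.tail = List.ofFn (fun k => ((σ k : ℕ), i k)) ∧ f = MonoidAlgebra.single w 1}

/-- `P_n^L(V) = P_n^L / (P_n^L ∩ Id^L(V))`. -/
abbrev multilinearQuotient {F L : Type u} {I : Type v} [Field F] [LieRing L] [LieAlgebra F L]
    (b : Module.Basis I F (UniversalEnvelopingAlgebra F L)) (V : Set (LAlg F L)) (n : ℕ) :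
    Type (max u v) :=
  multilinearPoly F I n ⧸ (classIdentities b V).submoduleOf (multilinearPoly F I n)

/-- The `n`th differential codimension `c_n^L(V) = dim P_n^L(V)`. -/
noncomputable def codim {F L : Type u} {I : Type v} [Field F] [LieRing L] [LieAlgebra F L]
    (b : Module.Basis I F (UniversalEnvelopingAlgebra F L)) (V : Set (LAlg F L)) (n : ℕ) : ℕ :=
  Module.finrank F (multilinearQuotient b V n)

/-- The codimensions of `V` are finite and polynomially bounded. -/
def HasPolynomialGrowth {F L : Type u} {I : Type v} [Field F] [LieRing L] [LieAlgebra F L]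
    (b : Module.Basis I F (UniversalEnvelopingAlgebra F L)) (V : Set (LAlg F L)) : Prop :=
  (∀ n : ℕ, 1 ≤ n → Module.Finite F (multilinearQuotient b V n)) ∧
    ∃ C k : ℕ, ∀ n : ℕ, 1 ≤ n → codim b V n ≤ C * n ^ k

/-- The codimensions of `V` are finite and lie between two exponentials, the lower one of base
greater than one, for all large `n`. -/
def HasExponentialGrowth {F L : Type u} {I : Type v} [Field F] [LieRing L] [LieAlgebra F L]
    (b : Module.Basis I F (UniversalEnvelopingAlgebra F L)) (V : Set (LAlg F L)) : Prop :=
  (∀ n : ℕ, 1 ≤ n → Module.Finite F (multilinearQuotient b V n)) ∧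
    ∃ r s : ℝ, 1 < r ∧ ∃ N : ℕ, ∀ n : ℕ, N ≤ n →
      r ^ n ≤ (codim b V n : ℝ) ∧ (codim b V n : ℝ) ≤ s ^ n

/-- `V` is not of polynomial growth, but every proper `L`-subvariety of `V` is. -/
def HasAlmostPolynomialGrowth {F L : Type u} {I : Type v} [Field F] [LieRing L] [LieAlgebra F L]
    (b : Module.Basis I F (UniversalEnvelopingAlgebra F L)) (V : Set (LAlg F L)) : Prop :=
  ¬ HasPolynomialGrowth b V ∧
    ∀ W : Set (LAlg F L), IsLVariety b W → W ⊂ V → HasPolynomialGrowth b W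

/-- The algebra `UT_2` of upper triangular `2 × 2` matrices over `F`. -/
abbrev UT2 (F : Type u) [Field F] : Subalgebra F (Matrix (Fin 2) (Fin 2) F) :=
  Matrix.blockTriangularSubalgebra F F (id : Fin 2 → Fin 2)

/-- The matrix unit `e_{12}` in `UT_2`. -/
def UT2.e12 (F : Type u) [Field F] : UT2 F :=
  ⟨Matrix.single 0 1 1, Matrix.mem_blockTriangularSubalgebra.2 (by
    intro i j h
    fin_cases i <;> fin_cases j <;> simp at h ⊢)⟩

/-- The inner derivation `δ` of `UT_2` induced by `2⁻¹ e_{12}`: `δ(a) = 2⁻¹ (e_{12} a - a e_{12})`.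
The bracket of `UT_2` is the commutator. -/
noncomputable def UT2.delta (F : Type u) [Field F] : Module.End F (UT2 F) :=
  LieAlgebra.ad F (UT2 F) ((2⁻¹ : F) • UT2.e12 F)

/-- `UT_2^δ`: the algebra `UT_2` on which `L` acts as the one-dimensional Lie algebra `Fδ`, through
a homomorphism `φ` of Lie algebras with image `Fδ`. -/
noncomputable abbrev UT2delta {F L : Type u} [Field F] [LieRing L] [LieAlgebra F L]
    (φ : L →ₗ⁅F⁆ Module.End F (UT2 F))
    (hφ : LinearMap.range (φ : L →ₗ[F] Module.End F (UT2 F)) = F ∙ UT2.delta F) : LAlg F L where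
  carrier := UT2 F
  action := φ
  leibniz := by
    intro γ x y
    have h : φ γ ∈ F ∙ UT2.delta F := by
      rw [← hφ]
      exact ⟨γ, rfl⟩
    obtain ⟨c, hc⟩ := Submodule.mem_span_singleton.1 h
    rw [← hc]
    simp only [UT2.delta, LinearMap.smul_apply, LieAlgebra.ad_apply, Ring.lie_def, smul_mul_assoc,
      mul_smul_comm, ← smul_sub, ← smul_add]
    congr 2
    rw [sub_mul, mul_sub, mul_assoc, mul_assoc, mul_assoc]
    abel

/-- `UT_2` with the trivial `L`-action. -/
noncomputable abbrev UT2triv (F L : Type u) [Field F] [LieRing L] [LieAlgebra F L] : LAlg F L where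
  carrier := UT2 F
  action := 0
  leibniz := by
    intro γ x y
    simp

/-! On `UT2delta`, each u in U(L) acts as ε + βδ because δ² = 0, and on `UT2triv` as the same scalar
ε (`UT2delta_uAction`). Since δ(x) depends only on the diagonal of x and lands in F e₁₂, the β-terms
at x and at its diagonal part agree and cancel on subtraction. This cancellation survives products:
for fixed diagonals, the upper right entry of a product is linear in the upper right entries of the
factors. Hence every value of f on `UT2triv` is read off from two values of f on `UT2delta`
(`isDiff_eval`), so identities pass from `UT2delta` to `UT2triv`. The inclusion of varieties is
proper because δ ≠ 0.

Growth: multilinear evaluation on a d-dimensional algebra gives c_n ≤ d^n · d, and monomials indexed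
by subsets, separated by test matrices in `UT2triv`, give c_{m+1} ≥ 2^m for any class containing
`UT2triv`. Thus both varieties grow exponentially, and the smaller one refutes almost polynomial
growth of the larger. -/

/-! ### Differential identities, varieties and the upper bound for codimensions -/

section General

variable {F L : Type u} {I : Type v} [Field F] [LieRing L] [LieAlgebra F L]
  (b : Module.Basis I F (UniversalEnvelopingAlgebra F L))

/-- Passing to a monoid turns evaluation of a word into a `List.prod`; it is used with the
unitization and with the full matrix algebra. -/
theorem FreeSemigroup.map_lift_eq_prod {α S M : Type*} [Semigroup S] [Monoid M] (g : S →ₙ* M)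
    (f : α → S) (w : FreeSemigroup α) :
    g (FreeSemigroup.lift f w) = ((w.head :: w.tail).map (g ∘ f)).prod := by
  induction w using FreeSemigroup.recOnMul with
  | ih1 x =>
    rw [FreeSemigroup.lift_of]
    simp [FreeSemigroup.of]
  | ih2 x y hx hy =>
    rw [map_mul, map_mul, hx, hy, FreeSemigroup.head_mul, FreeSemigroup.tail_mul,
      ← List.cons_append, List.map_append, List.prod_append]

/-- By the universal property, ι lifts to an algebra map U(L) → S, whose composite with the
inclusion of S must be the identity. -/
theorem UniversalEnvelopingAlgebra.mem_subalgebra_of_ι_mem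
    (S : Subalgebra F (UniversalEnvelopingAlgebra F L))
    (hS : ∀ x : L, UniversalEnvelopingAlgebra.ι F x ∈ S) (u : UniversalEnvelopingAlgebra F L) :
    u ∈ S := by
  let f : L →ₗ⁅F⁆ S :=
    { toFun := fun x => ⟨UniversalEnvelopingAlgebra.ι F x, hS x⟩
      map_add' := fun x y => Subtype.ext (map_add _ x y)
      map_smul' := fun c x => Subtype.ext (map_smul _ c x)
      map_lie' := fun {x y} => Subtype.ext (LieHom.map_lie _ x y) }
  have h : S.val.comp (UniversalEnvelopingAlgebra.lift F f) = AlgHom.id F _ := by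
    apply UniversalEnvelopingAlgebra.hom_ext
    ext x
    change ((UniversalEnvelopingAlgebra.lift F f (UniversalEnvelopingAlgebra.ι F x) : S) :
      UniversalEnvelopingAlgebra F L) = UniversalEnvelopingAlgebra.ι F x
    rw [UniversalEnvelopingAlgebra.lift_ι_apply]
    rfl
  have hu := congrArg (fun g => g u) h
  change ((UniversalEnvelopingAlgebra.lift F f u : S) : UniversalEnvelopingAlgebra F L) = u at hu
  rw [← hu]
  exact Subtype.property _

theorem LAlg.eval_single (A : LAlg F L) (a : ℕ → A.carrier) (w : FreeSemigroup (ℕ × I)) (c : F) :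
    A.eval b a (MonoidAlgebra.single w c) =
      c • FreeSemigroup.lift (fun p : ℕ × I => A.uAction (b p.2) (a p.1)) w := by
  simp [LAlg.eval, MonoidAlgebra.liftMagma]

theorem mem_varL_self (A : LAlg F L) : A ∈ varL b A := fun _ hf => hf

theorem classIdentities_varL (A : LAlg F L) : classIdentities b (varL b A) = A.identities b := by
  apply le_antisymm
  · exact iInf₂_le A (mem_varL_self b A)
  · exact le_iInf₂ fun B hB => hB

theorem isLVariety_varL (A : LAlg F L) : IsLVariety b (varL b A) :=
  ⟨A.identities b, rfl⟩

theorem varL_subset_varL {A B : LAlg F L} (h : A ∈ varL b B) : varL b A ⊆ varL b B :=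
  fun _ hC f hf => hC f (h f hf)

/-- Evaluation of a multilinear differential polynomial is multilinear. -/
theorem exists_multilinearMap_eval (A : LAlg F L) (n : ℕ) {f : DiffPoly F I}
    (hf : f ∈ multilinearPoly F I n) :
    ∃ m : MultilinearMap F (fun _ : Fin n => A.carrier) A.carrier,
      ∀ a : ℕ → A.carrier, A.eval b a f = m (fun k => a k) := by
  induction hf using Submodule.span_induction with
  | zero => exact ⟨0, fun a => by simp⟩
  | add f g _ _ hf hg =>
    obtain ⟨m, hm⟩ := hf
    obtain ⟨m', hm'⟩ := hg
    exact ⟨m + m', fun a => by rw [map_add, hm, hm', add_apply]⟩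
  | smul c f _ hf =>
    obtain ⟨m, hm⟩ := hf
    exact ⟨c • m, fun a => by rw [map_smul, hm, smul_apply]⟩
  | mem f hf =>
    obtain ⟨w, σ, i, hw, rfl⟩ := hf
    -- The n-fold product map needs a unit, so the product is formed in the unitization and
    -- projected back to A.
    refine ⟨(Unitization.sndHom F F A.carrier).compMultilinearMap
      (((MultilinearMap.mkPiAlgebraFin F n (Unitization F A.carrier)).compLinearMap
        fun k => (Unitization.inrHom F F A.carrier).comp (A.uAction (b (i k)))).domDomCongr σ),
      fun a => ?_⟩
    have h := FreeSemigroup.map_lift_eq_prod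
      (Unitization.inrNonUnitalAlgHom F A.carrier : A.carrier →ₙ* Unitization F A.carrier)
      (fun p : ℕ × I => A.uAction (b p.2) (a p.1)) w
    rw [hw, List.map_ofFn] at h
    rw [LAlg.eval_single, one_smul, ← Unitization.snd_inr F (FreeSemigroup.lift _ w)]
    exact congrArg (Unitization.sndHom F F A.carrier) h

/-- The values of a differential polynomial at all tuples of basis vectors, as a linear map. -/
noncomputable def LAlg.evalBasis (A : LAlg F L) {ι : Type*} (e : Module.Basis ι F A.carrier)
    (n : ℕ) : multilinearPoly F I n →ₗ[F] ((Fin n → ι) → A.carrier) where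
  toFun f v := A.eval b (fun j => if h : j < n then e (v ⟨j, h⟩) else 0) f
  map_add' f g := by ext v; simp
  map_smul' c f := by ext v; simp

theorem LAlg.evalBasis_apply (A : LAlg F L) {ι : Type*} (e : Module.Basis ι F A.carrier) (n : ℕ)
    (f : multilinearPoly F I n) (v : Fin n → ι) :
    A.evalBasis b e n f v = A.eval b (fun j => if h : j < n then e (v ⟨j, h⟩) else 0) f :=
  rfl

/-- A multilinear map is determined by its values on basis tuples; variables of index at least n do
not occur, so their value 0 is harmless. -/
theorem LAlg.ker_evalBasis (A : LAlg F L) {ι : Type*} [Finite ι] (e : Module.Basis ι F A.carrier)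
    (n : ℕ) :
    LinearMap.ker (A.evalBasis b e n) = (A.identities b).submoduleOf (multilinearPoly F I n) := by
  ext f
  rw [LinearMap.mem_ker]
  change _ ↔ ∀ a, A.eval b a (f : DiffPoly F I) = 0
  constructor
  · intro h a
    obtain ⟨m, hm⟩ := exists_multilinearMap_eval b A n f.2
    have : m = 0 := by
      refine Module.Basis.ext_multilinear (fun _ => e) fun v => ?_
      have hv := congrFun h v
      rw [A.evalBasis_apply, hm] at hv
      simpa using hv
    rw [hm, this, zero_apply]
  · intro h
    funext v
    rw [A.evalBasis_apply, h, Pi.zero_apply]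

theorem multilinearQuotient_varL_finite (A : LAlg F L) [Module.Finite F A.carrier] (n : ℕ) :
    Module.Finite F (multilinearQuotient b (varL b A) n) ∧
      codim b (varL b A) n ≤
        Module.finrank F A.carrier ^ n * Module.finrank F A.carrier := by
  let e := Module.finBasis F A.carrier
  have hker := A.ker_evalBasis b e n
  rw [← classIdentities_varL] at hker
  let g : multilinearQuotient b (varL b A) n →ₗ[F]
      ((Fin n → Fin (Module.finrank F A.carrier)) → A.carrier) :=
    Submodule.liftQ _ (A.evalBasis b e n) hker.ge
  have hg : Function.Injective g := by
    rw [← LinearMap.ker_eq_bot]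
    exact Submodule.ker_liftQ_eq_bot _ _ _ hker.le
  refine ⟨Module.Finite.of_injective g hg, ?_⟩
  refine (LinearMap.finrank_le_finrank_of_injective hg).trans ?_
  simp [Module.finrank_pi_fintype]

end General

/-! ### Exponential lower bound from the trivial action -/

section LowerBound

variable {F L : Type u} {I : Type v} [Field F] [LieRing L] [LieAlgebra F L]
  (b : Module.Basis I F (UniversalEnvelopingAlgebra F L))

theorem exists_word_of_perm (F : Type u) {I : Type v} [Field F] (i : I) {n : ℕ} (hn : n ≠ 0)
    {l : List (Fin n)} (hl : l.Perm (List.finRange n)) :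
    ∃ w : FreeSemigroup (ℕ × I), w.head :: w.tail = l.map (fun j : Fin n => ((j : ℕ), i)) ∧
      (MonoidAlgebra.single w 1 : DiffPoly F I) ∈ multilinearPoly F I n := by
  have hlen : l.length = n := by simpa using hl.length_eq
  have hnodup : l.Nodup := hl.nodup_iff.2 (List.nodup_finRange n)
  have hinj : Function.Injective fun k : Fin n => l.get (k.cast hlen.symm) := fun k k' h =>
    Fin.cast_injective _ (hnodup.injective_get h)
  let σ : Equiv.Perm (Fin n) := Equiv.ofBijective _ (Finite.injective_iff_bijective.1 hinj)
  have hσ : List.ofFn (fun k => ((σ k : ℕ), i)) = l.map fun j : Fin n => ((j : ℕ), i) := by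
    apply List.ext_getElem
    · simp [hlen]
    · intro k h₁ h₂
      simp [σ]
  obtain ⟨x, t, hxt⟩ := List.exists_cons_of_ne_nil
    (l := l.map fun j : Fin n => ((j : ℕ), i)) (by
      intro h
      rw [List.map_eq_nil_iff] at h
      exact hn (by rw [← hlen, h, List.length_nil]))
  exact ⟨⟨x, t⟩, hxt.symm,
    Submodule.subset_span ⟨⟨x, t⟩, σ, fun _ => i, by rw [hσ, hxt], rfl⟩⟩

/-- Each element of `U(L)` acts on `UT_2` with the trivial `L`-action as a scalar. -/
theorem UT2triv_uAction (u : UniversalEnvelopingAlgebra F L) :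
    ∃ ε : F, ∀ x : UT2 F, (UT2triv F L).uAction u x = ε • x := by
  let S : Subalgebra F (UniversalEnvelopingAlgebra F L) :=
    (⊥ : Subalgebra F (Module.End F (UT2triv F L).carrier)).comap (UT2triv F L).uAction
  have hu : u ∈ S := UniversalEnvelopingAlgebra.mem_subalgebra_of_ι_mem S (fun γ => by
    change (UT2triv F L).uAction _ ∈ (⊥ : Subalgebra F (Module.End F (UT2triv F L).carrier))
    rw [LAlg.uAction, UniversalEnvelopingAlgebra.lift_ι_apply]
    exact zero_mem _) u
  obtain ⟨ε, hε⟩ := Algebra.mem_bot.1 (show (UT2triv F L).uAction u ∈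
    (⊥ : Subalgebra F (Module.End F (UT2triv F L).carrier)) from hu)
  exact ⟨ε, fun x => by rw [← hε]; rfl⟩

/-- The basis need not contain 1, but if all its elements acted as zero, so would 1, which acts as
the identity. -/
theorem exists_basis_uAction_ne_zero :
    ∃ (i : I) (c : F), c ≠ 0 ∧ ∀ x : UT2 F, (UT2triv F L).uAction (b i) x = c • x := by
  by_contra! h
  have h0 : (UT2triv F L).uAction.toLinearMap = 0 := by
    refine b.ext fun i => ?_
    obtain ⟨c, hc⟩ := UT2triv_uAction (b i)
    by_cases h' : c = 0
    · refine LinearMap.ext fun x => (hc x).trans ?_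
      rw [h', zero_smul]
      rfl
    · obtain ⟨x, hx⟩ := h i c h'
      exact absurd (hc x) hx
  have h1 : (UT2triv F L).uAction 1 = 0 := DFunLike.congr_fun h0 1
  rw [map_one] at h1
  exact one_ne_zero (α := UT2 F) (congrArg (fun f : Module.End F (UT2 F) => f 1) h1)

/-- The sequence of the indices in `T`, the index `0`, and the indices outside of `T`. -/
def splitList {m : ℕ} (T : Fin m → Bool) : List (Fin (m + 1)) :=
  ((List.finRange m).filter T).map Fin.succ ++
    0 :: ((List.finRange m).filter fun j => !T j).map Fin.succ

theorem splitList_perm {m : ℕ} (T : Fin m → Bool) :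
    (splitList T).Perm (List.finRange (m + 1)) := by
  rw [List.finRange_succ]
  refine List.perm_middle.trans (List.Perm.cons _ ?_)
  rw [← List.map_append]
  exact (List.filter_append_perm T _).map _

/-- The test matrices: `e_{12}` at the index `0`, `e_{11}` on `S` and `e_{22}` outside of `S`. -/
def testMatrix (F : Type u) [Field F] {m : ℕ} (S : Fin m → Bool) : Fin (m + 1) → UT2 F :=
  Fin.cons (UT2.e12 F) fun j =>
    ⟨Matrix.diagonal ![if S j then 1 else 0, if S j then 0 else 1],
      Matrix.mem_blockTriangularSubalgebra.2 (Matrix.blockTriangular_diagonal _)⟩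

/-- The product survives exactly when all factors left of e₁₂ are e₁₁ (T ⊆ S) and all factors right
of it are e₂₂ (the complement of T misses S). -/
theorem prod_testMatrix_splitList {m : ℕ} (S T : Fin m → Bool) :
    ((splitList T).map fun j => (testMatrix F S j).1).prod 0 1 = if T = S then 1 else 0 := by
  let d : Fin m → Fin 2 → F := fun j => ![if S j then 1 else 0, if S j then 0 else 1]
  have hd : ∀ l : List (Fin m), (l.map fun j => (testMatrix F S j.succ).1).prod =
      Matrix.diagonal (l.map d).prod := fun l => by
    have := map_list_prod (Matrix.diagonalRingHom (Fin 2) F) (l.map d)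
    rw [List.map_map] at this
    exact this.symm
  have hprod : ∀ (l : List (Fin m)) (k : Fin 2),
      (l.map d).prod k = (l.map fun j => d j k).prod := fun l k => by
    have := map_list_prod (Pi.evalMonoidHom (fun _ : Fin 2 => F) k) (l.map d)
    rw [List.map_map] at this
    exact this
  have hentry : ∀ x y : Fin 2 → F, (Matrix.diagonal x * (Matrix.single 0 1 1 *
      Matrix.diagonal y) : Matrix (Fin 2) (Fin 2) F) 0 1 = x 0 * y 1 := fun x y => by
    simp [Matrix.diagonal_mul, Matrix.mul_diagonal]
  rw [splitList, List.map_append, List.prod_append, List.map_cons, List.prod_cons, List.map_map,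
    List.map_map]
  change ((((List.filter T _).map fun j : Fin m => (testMatrix F S j.succ).1).prod *
    (Matrix.single 0 1 1 *
      ((List.filter _ _).map fun j : Fin m => (testMatrix F S j.succ).1).prod) : Matrix (Fin 2) (Fin 2) F)) 0 1 = _
  rw [hd, hd, hentry, hprod, hprod]
  split_ifs with h
  · subst h
    rw [List.prod_eq_one, List.prod_eq_one, one_mul]
    · simp +contextual [d]
    · simp +contextual [d]
  · obtain ⟨j, hj⟩ := Function.ne_iff.1 h
    rw [mul_eq_zero, List.prod_eq_zero_iff, List.prod_eq_zero_iff]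
    cases hT : T j
    · right
      have : S j = true := by simpa [hT] using hj
      exact List.mem_map.2 ⟨j, by simp [hT], by simp [d, this]⟩
    · left
      have : S j = false := by simpa [hT] using hj
      exact List.mem_map.2 ⟨j, by simp [hT], by simp [d, this]⟩

theorem two_pow_le_codim {V : Set (LAlg F L)} (hV : UT2triv F L ∈ V) (m : ℕ)
    [Module.Finite F (multilinearQuotient b V (m + 1))] : 2 ^ m ≤ codim b V (m + 1) := by
  obtain ⟨i, c, hc, hi⟩ := exists_basis_uAction_ne_zero b
  -- The factor c⁻¹ undoes the scalar by which `b i` acts, so the evaluated letters are exactly the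
  -- test matrices.
  let a : (Fin m → Bool) → ℕ → UT2 F := fun S j =>
    if h : j < m + 1 then c⁻¹ • testMatrix F S ⟨j, h⟩ else 0
  let g : multilinearPoly F I (m + 1) →ₗ[F] ((Fin m → Bool) → F) :=
    { toFun := fun f S => ((UT2triv F L).eval b (a S) f : UT2 F).1 0 1
      map_add' := fun f f' => by
        funext S
        rw [Submodule.coe_add, map_add]
        rfl
      map_smul' := fun t f => by
        funext S
        rw [Submodule.coe_smul, map_smul]
        rfl }
  have hker : (classIdentities b V).submoduleOf (multilinearPoly F I (m + 1)) ≤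
      LinearMap.ker g := fun f hf => by
    have hf' : (f : DiffPoly F I) ∈ (UT2triv F L).identities b :=
      iInf₂_le (f := fun A _ => LAlg.identities b A) (UT2triv F L) hV hf
    rw [LinearMap.mem_ker]
    funext S
    change ((UT2triv F L).eval b (a S) f : UT2 F).1 0 1 = 0
    rw [hf' (a S)]
    rfl
  have hpre : ∀ T : Fin m → Bool, ∃ f, g f = Pi.single T 1 := fun T => by
    obtain ⟨w, hw, hwP⟩ := exists_word_of_perm F i m.succ_ne_zero (splitList_perm T)
    refine ⟨⟨_, hwP⟩, funext fun S => ?_⟩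
    change ((UT2triv F L).eval b (a S) (MonoidAlgebra.single w 1) : UT2 F).1 0 1 = _
    have h := FreeSemigroup.map_lift_eq_prod
      ((UT2 F).val : UT2 F →ₙ* Matrix (Fin 2) (Fin 2) F)
      (fun p : ℕ × I => (UT2triv F L).uAction (b p.2) (a S p.1)) w
    have hval : ∀ j : Fin (m + 1),
        (UT2triv F L).uAction (b i) (a S j) = testMatrix F S j := fun j => by
      rw [hi, show a S j = c⁻¹ • testMatrix F S j by
        simp only [a, dif_pos j.2], smul_inv_smul₀ hc]
    rw [hw, List.map_map] at h
    have h' : (((UT2 F).val : UT2 F →ₙ* Matrix (Fin 2) (Fin 2) F) ∘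
        (fun p : ℕ × I => (UT2triv F L).uAction (b p.2) (a S p.1))) ∘
        (fun j : Fin (m + 1) => ((j : ℕ), i)) = fun j => (testMatrix F S j).1 :=
      funext fun j => congrArg Subtype.val (hval j)
    rw [h'] at h
    rw [LAlg.eval_single, one_smul, Pi.single_apply]
    refine (congrFun (congrFun h 0) 1).trans ?_
    rw [prod_testMatrix_splitList]
    simp only [eq_comm]
  have hg : LinearMap.range g = ⊤ := by
    rw [eq_top_iff, ← (Pi.basisFun F (Fin m → Bool)).span_eq, Submodule.span_le]
    rintro _ ⟨T, rfl⟩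
    obtain ⟨f, hf⟩ := hpre T
    exact ⟨f, by rw [hf, Pi.basisFun_apply]⟩
  have hsurj : Function.Surjective (Submodule.liftQ _ g hker) := by
    rw [← LinearMap.range_eq_top, Submodule.range_liftQ, hg]
  simpa [codim] using LinearMap.finrank_le_finrank_of_surjective hsurj

theorem hasExponentialGrowth_varL {A : LAlg F L} [Module.Finite F A.carrier]
    (hA : UT2triv F L ∈ varL b A) : HasExponentialGrowth b (varL b A) := by
  -- Base 3/2 works from n = 3 on, as (3/2)³ = 27/8 ≤ 2²; squaring d + 1 absorbs the extra factor d
  -- of the upper bound.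
  refine ⟨fun n _ => (multilinearQuotient_varL_finite b A n).1, 3 / 2,
    ((Module.finrank F A.carrier : ℝ) + 1) ^ 2, by norm_num, 3, fun n hn => ⟨?_, ?_⟩⟩
  · obtain ⟨m, rfl⟩ := Nat.exists_eq_add_of_le' hn
    have := (multilinearQuotient_varL_finite b A (m + 2 + 1)).1
    have h := two_pow_le_codim b hA (m + 2)
    have h' : (2 : ℝ) ^ (m + 2) ≤ codim b (varL b A) (m + 3) := by exact_mod_cast h
    refine le_trans ?_ h'
    have hm : (3 / 2 : ℝ) ^ m ≤ 2 ^ m := pow_le_pow_left₀ (by norm_num) (by norm_num) m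
    have hp : (0 : ℝ) < 2 ^ m := by positivity
    rw [pow_add, pow_add]
    nlinarith
  · have h : (codim b (varL b A) n : ℝ) ≤
        (Module.finrank F A.carrier : ℝ) ^ n * (Module.finrank F A.carrier : ℝ) := by
      exact_mod_cast (multilinearQuotient_varL_finite b A n).2
    set d : ℝ := (Module.finrank F A.carrier : ℝ)
    have hd : 0 ≤ d := Nat.cast_nonneg _
    have h1 : d ^ n ≤ (d + 1) ^ n := pow_le_pow_left₀ hd (by linarith) n
    have h2 : d ≤ (d + 1) ^ n :=
      (by linarith : d ≤ d + 1).trans (le_self_pow₀ (by linarith) (by omega))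
    calc _ ≤ d ^ n * d := h
      _ ≤ (d + 1) ^ n * (d + 1) ^ n := mul_le_mul h1 h2 hd (by positivity)
      _ = ((d + 1) ^ 2) ^ n := by rw [← pow_add, ← pow_mul, two_mul]

theorem HasExponentialGrowth.not_hasPolynomialGrowth {V : Set (LAlg F L)}
    (hV : HasExponentialGrowth b V) : ¬ HasPolynomialGrowth b V := by
  rintro ⟨-, C, k, hCk⟩
  obtain ⟨-, r, s, hr, N, hN⟩ := hV
  -- With this constant, (C + 1) n^k ≤ r^n for large n, against r^n ≤ C n^k.
  have h := (isLittleO_pow_const_const_pow_of_one_lt (R := ℝ) k hr).def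
    (c := 1 / (C + 1)) (by positivity)
  obtain ⟨n, hn, hn1⟩ := (h.and (Filter.eventually_ge_atTop (max N 1))).exists
  have hrn : 0 < r ^ n := by positivity
  have h1 : r ^ n ≤ C * (n : ℝ) ^ k := (hN n (le_of_max_le_left hn1)).1.trans
    (by exact_mod_cast hCk n (le_of_max_le_right hn1))
  rw [Real.norm_of_nonneg (by positivity), Real.norm_of_nonneg hrn.le, one_div,
    inv_mul_eq_div, le_div_iff₀ (by positivity)] at hn
  have h2 : 0 ≤ (n : ℝ) ^ k := by positivity
  have h3 : (n : ℝ) ^ k = 0 := by nlinarith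
  rw [h3, mul_zero] at h1
  linarith

end LowerBound

/-! ### Comparing the two actions on `UT2` -/

section Inclusion

variable {F L : Type u} {I : Type v} [Field F] [LieRing L] [LieAlgebra F L]
  (b : Module.Basis I F (UniversalEnvelopingAlgebra F L))
  (φ : L →ₗ⁅F⁆ Module.End F (UT2 F))
  (hφ : LinearMap.range (φ : L →ₗ[F] Module.End F (UT2 F)) = F ∙ UT2.delta F)

theorem UT2.apply_one_zero (x : UT2 F) : x.1 1 0 = 0 :=
  Matrix.mem_blockTriangularSubalgebra.1 x.2 (show (id (0 : Fin 2)) < id 1 by decide)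

theorem UT2.delta_apply (x : UT2 F) :
    (UT2.delta F x).1 = Matrix.single 0 1 (2⁻¹ * (x.1 1 1 - x.1 0 0)) := by
  have h : (UT2.delta F x).1 = ((2⁻¹ : F) • Matrix.single 0 1 1) * x.1 -
      x.1 * ((2⁻¹ : F) • Matrix.single 0 1 1) := rfl
  have h0 := UT2.apply_one_zero x
  rw [h]
  ext i j
  fin_cases i <;> fin_cases j <;> simp [Matrix.mul_apply, Fin.sum_univ_two, h0]
  ring

theorem UT2.delta_delta (x : UT2 F) : UT2.delta F (UT2.delta F x) = 0 := by
  apply Subtype.ext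
  rw [UT2.delta_apply, UT2.delta_apply]
  simp

/-- The elements acting in this way form a subalgebra, closed under products because δ² = 0, and it
contains L with ε = 0. -/
theorem UT2delta_uAction (u : UniversalEnvelopingAlgebra F L) :
    ∃ ε β : F, (∀ x : UT2 F, (UT2triv F L).uAction u x = ε • x) ∧
      ∀ x : UT2 F, (UT2delta φ hφ).uAction u x = ε • x + β • UT2.delta F x := by
  let S : Subalgebra F (UniversalEnvelopingAlgebra F L) :=
    { carrier := {u | ∃ ε β : F, (UT2triv F L).uAction u = ε • (1 : Module.End F (UT2 F)) ∧
        (UT2delta φ hφ).uAction u = ε • (1 : Module.End F (UT2 F)) + β • UT2.delta F}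
      mul_mem' := by
        rintro u w ⟨ε, β, h₁, h₂⟩ ⟨ε', β', h₁', h₂'⟩
        have hδ : UT2.delta F * UT2.delta F = 0 := LinearMap.ext UT2.delta_delta
        refine ⟨ε * ε', ε * β' + β * ε', ?_, ?_⟩
        · rw [map_mul, h₁, h₁']
          change (ε • (1 : Module.End F (UT2 F))) * (ε' • (1 : Module.End F (UT2 F))) = _
          rw [smul_mul_smul_comm, one_mul]
        · rw [map_mul, h₂, h₂']
          change (ε • (1 : Module.End F (UT2 F)) + β • UT2.delta F) *
            (ε' • (1 : Module.End F (UT2 F)) + β' • UT2.delta F) = _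
          rw [add_mul, mul_add, mul_add]
          simp only [smul_mul_smul_comm, one_mul, mul_one, hδ, smul_zero, add_zero, add_smul]
          abel
      add_mem' := by
        rintro u w ⟨ε, β, h₁, h₂⟩ ⟨ε', β', h₁', h₂'⟩
        refine ⟨ε + ε', β + β', ?_, ?_⟩
        · rw [map_add, h₁, h₁', add_smul]
        · rw [map_add, h₂, h₂', add_smul, add_smul]
          exact add_add_add_comm _ _ _ _
      algebraMap_mem' := fun c => by
        refine ⟨c, 0, ?_, ?_⟩
        · rw [AlgHom.commutes]
          exact Algebra.algebraMap_eq_smul_one c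
        · rw [AlgHom.commutes, zero_smul, add_zero]
          exact Algebra.algebraMap_eq_smul_one c }
  obtain ⟨ε, β, h₁, h₂⟩ : u ∈ S := UniversalEnvelopingAlgebra.mem_subalgebra_of_ι_mem S (fun γ => by
    have hγ : φ γ ∈ F ∙ UT2.delta F := by
      rw [← hφ]
      exact ⟨γ, rfl⟩
    obtain ⟨β, hβ⟩ := Submodule.mem_span_singleton.1 hγ
    refine ⟨0, β, ?_, ?_⟩
    · rw [LAlg.uAction, UniversalEnvelopingAlgebra.lift_ι_apply, zero_smul]
      rfl
    · rw [LAlg.uAction, UniversalEnvelopingAlgebra.lift_ι_apply, zero_smul, zero_add, hβ]) u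
  exact ⟨ε, β, fun x => by rw [h₁]; rfl, fun x => by rw [h₂]; rfl⟩

/-- The diagonal part of an upper triangular matrix. -/
def UT2.diag (x : UT2 F) : UT2 F :=
  ⟨Matrix.diagonal fun i => x.1 i i,
    Matrix.mem_blockTriangularSubalgebra.2 (Matrix.blockTriangular_diagonal _)⟩

/-- `t` has the same diagonal as `x` and `y`, and its upper right entry is the difference of
theirs. -/
structure UT2.IsDiff (t x y : UT2 F) : Prop where
  diag_left : ∀ i, t.1 i i = x.1 i i
  diag_right : ∀ i, t.1 i i = y.1 i i
  upper : t.1 0 1 = x.1 0 1 - y.1 0 1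

theorem UT2.IsDiff.mul {t x y t' x' y' : UT2 F} (h : UT2.IsDiff t x y)
    (h' : UT2.IsDiff t' x' y') : UT2.IsDiff (t * t') (x * x') (y * y') := by
  obtain ⟨h₁, h₂, h₃⟩ := h
  obtain ⟨h₁', h₂', h₃'⟩ := h'
  have hmul : ∀ (z z' : UT2 F) i j, (z * z').1 i j = z.1 i 0 * z'.1 0 j + z.1 i 1 * z'.1 1 j :=
    fun z z' i j => by
      change (z.1 * z'.1) i j = _
      rw [Matrix.mul_apply, Fin.sum_univ_two]
  refine ⟨fun i => ?_, fun i => ?_, ?_⟩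
  · fin_cases i <;> simp [hmul, UT2.apply_one_zero, h₁, h₁']
  · fin_cases i <;> simp [hmul, UT2.apply_one_zero, h₂, h₂']
  · rw [hmul, hmul, hmul, h₃, h₃', mul_sub, sub_mul, ← h₁ 0, ← h₂ 0, ← h₁' 1, ← h₂' 1]
    ring

theorem UT2.IsDiff.add {t x y t' x' y' : UT2 F} (h : UT2.IsDiff t x y)
    (h' : UT2.IsDiff t' x' y') : UT2.IsDiff (t + t') (x + x') (y + y') := by
  obtain ⟨h₁, h₂, h₃⟩ := h
  obtain ⟨h₁', h₂', h₃'⟩ := h'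
  refine ⟨fun i => ?_, fun i => ?_, ?_⟩
  · simp [h₁, h₁']
  · simp [h₂, h₂']
  · simp only [Subalgebra.coe_add, Matrix.add_apply, h₃, h₃']
    ring

theorem UT2.IsDiff.smul {t x y : UT2 F} (c : F) (h : UT2.IsDiff t x y) :
    UT2.IsDiff (c • t) (c • x) (c • y) := by
  obtain ⟨h₁, h₂, h₃⟩ := h
  refine ⟨fun i => ?_, fun i => ?_, ?_⟩
  · simp [h₁]
  · simp [h₂]
  · simp [h₃, mul_sub]

/-- Since x and `UT2.diag x` have the same image under δ, the subtraction leaves only ε times the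
upper right entry of x. -/
theorem isDiff_uAction (u : UniversalEnvelopingAlgebra F L) (x : UT2 F) :
    UT2.IsDiff ((UT2triv F L).uAction u x) ((UT2delta φ hφ).uAction u x)
      ((UT2delta φ hφ).uAction u (UT2.diag x)) := by
  obtain ⟨ε, β, h₁, h₂⟩ := UT2delta_uAction φ hφ u
  rw [h₁, h₂, h₂]
  refine ⟨fun i => ?_, fun i => ?_, ?_⟩
  · fin_cases i <;> simp [UT2.delta_apply]
  · fin_cases i <;> simp [UT2.delta_apply, UT2.diag]
  · simp [UT2.delta_apply, UT2.diag]

theorem isDiff_eval (f : DiffPoly F I) (a : ℕ → UT2 F) :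
    UT2.IsDiff ((UT2triv F L).eval b a f) ((UT2delta φ hφ).eval b a f)
      ((UT2delta φ hφ).eval b (fun j => UT2.diag (a j)) f) := by
  induction f using MonoidAlgebra.induction_linear with
  | zero =>
    rw [map_zero, map_zero, map_zero]
    exact ⟨fun _ => rfl, fun _ => rfl, (sub_zero _).symm⟩
  | add f g hf hg =>
    rw [map_add, map_add, map_add]
    exact hf.add hg
  | single w c =>
    rw [LAlg.eval_single, LAlg.eval_single, LAlg.eval_single]
    refine UT2.IsDiff.smul c ?_
    induction w using FreeSemigroup.recOnMul with
    | ih1 p => exact isDiff_uAction φ hφ (b p.2) (a p.1)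
    | ih2 p w hp hw =>
      rw [map_mul, map_mul, map_mul]
      exact hp.mul hw

theorem UT2triv_mem_varL : UT2triv F L ∈ varL b (UT2delta φ hφ) := by
  intro f hf a
  obtain ⟨h₁, -, h₃⟩ := isDiff_eval b φ hφ f a
  -- The identity is used twice: at `a` here, and at the diagonal parts of `a` in the next rewrite.
  rw [hf] at h₁ h₃
  rw [hf] at h₃
  apply Subtype.ext
  ext i j
  fin_cases i <;> fin_cases j
  · exact h₁ 0
  · exact h₃.trans (sub_zero _)
  · exact UT2.apply_one_zero _
  · exact h₁ 1

theorem LAlg.exists_diffPoly_eval (u : UniversalEnvelopingAlgebra F L) :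
    ∃ f : DiffPoly F I, ∀ (A : LAlg F L) (a : ℕ → A.carrier),
      A.eval b a f = A.uAction u (a 0) := by
  refine ⟨∑ i ∈ (b.repr u).support, MonoidAlgebra.single (FreeSemigroup.of (0, i)) (b.repr u i),
    fun A a => ?_⟩
  conv_rhs => rw [← b.linearCombination_repr u, Finsupp.linearCombination_apply, Finsupp.sum,
    map_sum, LinearMap.sum_apply]
  rw [map_sum]
  refine Finset.sum_congr rfl fun i _ => ?_
  rw [LAlg.eval_single, FreeSemigroup.lift_of, map_smul, LinearMap.smul_apply]

theorem UT2delta_notMem_varL [CharZero F] : UT2delta φ hφ ∉ varL b (UT2triv F L) := by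
  intro h
  have hδ : UT2.delta F ∈ LinearMap.range (φ : L →ₗ[F] Module.End F (UT2 F)) := by
    rw [hφ]
    exact Submodule.mem_span_singleton_self _
  obtain ⟨γ, hγ⟩ := hδ
  obtain ⟨f, hf⟩ := LAlg.exists_diffPoly_eval b (UniversalEnvelopingAlgebra.ι F γ)
  -- Here δ(e₂₂) = 2⁻¹ e₁₂, which is nonzero in characteristic zero.
  let e : UT2 F := ⟨Matrix.diagonal ![0, 1],
    Matrix.mem_blockTriangularSubalgebra.2 (Matrix.blockTriangular_diagonal _)⟩
  have h0 := h f (fun a => by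
    rw [hf, LAlg.uAction, UniversalEnvelopingAlgebra.lift_ι_apply]
    rfl) (fun _ => e)
  rw [hf, LAlg.uAction, UniversalEnvelopingAlgebra.lift_ι_apply] at h0
  have h1 : UT2.delta F e = 0 := by
    rw [← hγ]
    exact h0
  have h2 := congrArg (fun x : UT2 F => x.1 0 1) h1
  simp [UT2.delta_apply, e] at h2

end Inclusion

theorem mainTheorem2 {F L : Type u} {I : Type v} [Field F] [CharZero F] [LieRing L]
    [LieAlgebra F L] (b : Module.Basis I F (UniversalEnvelopingAlgebra F L))
    (φ : L →ₗ⁅F⁆ Module.End F (UT2 F))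
    (hφ : LinearMap.range (φ : L →ₗ[F] Module.End F (UT2 F)) = F ∙ UT2.delta F) :
    HasExponentialGrowth b (varL b (UT2delta φ hφ)) ∧
    ¬ HasAlmostPolynomialGrowth b (varL b (UT2delta φ hφ)) ∧
    UT2triv F L ∈ varL b (UT2delta φ hφ) ∧
    varL b (UT2triv F L) ⊂ varL b (UT2delta φ hφ) ∧
    HasExponentialGrowth b (varL b (UT2triv F L)) := by
  have : Module.Finite F (UT2 F) :=
    Module.Finite.of_injective (UT2 F).val.toLinearMap Subtype.val_injective
  have : Module.Finite F (UT2delta φ hφ).carrier := this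
  have : Module.Finite F (UT2triv F L).carrier := this
  have hmem := UT2triv_mem_varL b φ hφ
  have hss : varL b (UT2triv F L) ⊂ varL b (UT2delta φ hφ) :=
    ⟨varL_subset_varL b hmem, fun h => UT2delta_notMem_varL b φ hφ (h (mem_varL_self b _))⟩
  have htriv := hasExponentialGrowth_varL b (mem_varL_self b (UT2triv F L))
  exact ⟨hasExponentialGrowth_varL b hmem,
    fun h => htriv.not_hasPolynomialGrowth b (h.2 _ (isLVariety_varL b _) hss), hmem, hss, htriv⟩
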